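/- **Setting.** An $n$-component virtual link diagram $D$ is a generic (smooth) immersion of $n$ ordered, oriented circles in the plane whose only singularities are transverse double points, each marked as a classical crossing (with over/under information) or as a virtual crossing. A base point system $\mathbf p=(p_1,\dots,p_n)$ consists of one point $p_i$ on each component, away from all crossings. The classical under-crossings and the base points cut $D$ into arcs; let $a_{i1},a_{i2},\dots,a_{i\,m_i+1}$ be the arcs of the $i$th component in the order in which they are met when starting from $p_i$ and following the orientation. Let $u_{ij}$ be the arc that passes over at the crossing between $a_{ij}$ and $a_{i\,j+1}$, let $\varepsilon_{ij}\in\{\pm1\}$ be the sign of that crossing, and put $v_{ij}=u_{i1}^{\varepsilon_{i1}}\cdots u_{ij}^{\varepsilon_{ij}}$ for $0\le j\le m_i$ (so $v_{i0}=1$). Let $w_i$ be the sum of the signs of the classical self-crossings of the $i$th component, and let $l_i=a_{i1}^{-w_i}v_{im_i}$ be the $i$th preferred longitude. Let $A$ be the free group on $\alpha_1,\dots,\alpha_n$ and $\overline A$ the free group on the set of arcs. Define homomorphisms $\eta_q=\eta_q(D,\mathbf p):\overline A\to A$ for $q\ge 1$ by $\eta_1(a_{ij})=\alpha_i$, $\eta_{q+1}(a_{i1})=\alpha_i$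 and $\eta_{q+1}(a_{ij})=\eta_q(v_{i\,j-1})^{-1}\alpha_i\,\eta_q(v_{i\,j-1})$ for $2\le j\le m_i+1$. Let $E:A\to\mathbb Z\langle\langle X_1,\dots,X_n\rangle\rangle^{\times}$ be the Magnus expansion, i.e. the homomorphism with $E(\alpha_i)=1+X_i$. For a sequence $j_1\dots j_s i$ of indices in $\{1,\dots,n\}$ with $s\ge1$ and an integer $q>s$, let $\mu^{(q)}_{(D,\mathbf p)}(j_1\dots j_s i)$ be the coefficient of $X_{j_1}\cdots X_{j_s}$ in $E(\eta_q(l_i))$. The Milnor number $\mu_{(D,\mathbf p)}(j_1\dots j_s i)$ is the common value of $\mu^{(q)}_{(D,\mathbf p)}(j_1\dots j_s i)$ for all $q>s$. A self-crossing virtualization replaces one classical crossing between two strands of the same component by a virtual crossing and leaves the rest of the diagram and the base points unchanged (diagrams being considered up to orientation-preserving diffeomorphism of the plane). **Theorem.** Let $(D,\mathbf p)$ and $(D',\mathbf p')$ be $n$-component virtual link diagrams with base point systems that are related by a single self-crossing virtualization. Then for every sequence $I=j_1\dots j_s i$ without repeated indices, the numbers $\mu^{(q)}_{(D,\mathbf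 p)}(I)$ and $\mu^{(q)}_{(D',\mathbf p')}(I)$ do not depend on $q>s$, and $$\mu_{(D,\mathbf p)}(I)=\mu_{(D',\mathbf p')}(I).$$ -/

import Mathlib

open scoped ContDiff

/-! ### Formal power series in non-commuting variables and the Magnus expansion -/

/-- The ring `ℤ⟨⟨X_i : i ∈ σ⟩⟩` of formal power series with integer coefficients in non-commuting
variables: a series is the family of its coefficients, `f.coeff [j₁, …, jₛ]` being the coefficient
of the monomial `X_{j₁} ⋯ X_{jₛ}`. -/
@[ext] structure NCPowerSeries (σ : Type) : Type where
  coeff : List σ → ℤ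

namespace NCPowerSeries

variable {σ : Type}

instance : Zero (NCPowerSeries σ) := ⟨⟨fun _ => 0⟩⟩

instance : One (NCPowerSeries σ) := ⟨⟨fun w => if w.length = 0 then 1 else 0⟩⟩

instance : Add (NCPowerSeries σ) := ⟨fun f g => ⟨fun w => f.coeff w + g.coeff w⟩⟩

instance : Neg (NCPowerSeries σ) := ⟨fun f => ⟨fun w => -f.coeff w⟩⟩

/-- Multiplication: sum over all ways to cut a monomial into two consecutive pieces. -/
instance : Mul (NCPowerSeries σ) :=
  ⟨fun f g => ⟨fun w =>
    ∑ k ∈ Finset.range (w.length + 1), f.coeff (w.take k) * g.coeff (w.drop k)⟩⟩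

theorem coeff_mul (f g : NCPowerSeries σ) (w : List σ) : (f * g).coeff w =
    ∑ k ∈ Finset.range (w.length + 1), f.coeff (w.take k) * g.coeff (w.drop k) := rfl

@[simp] theorem coeff_one (w : List σ) :
    (1 : NCPowerSeries σ).coeff w = if w.length = 0 then 1 else 0 := rfl

@[simp] theorem coeff_add (f g : NCPowerSeries σ) (w : List σ) :
    (f + g).coeff w = f.coeff w + g.coeff w := rfl

@[simp] theorem coeff_zero (w : List σ) : (0 : NCPowerSeries σ).coeff w = 0 := rfl

@[simp] theorem coeff_neg (f : NCPowerSeries σ) (w : List σ) : (-f).coeff w = -f.coeff w := rfl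

/-- The series whose coefficient at `w` is the coefficient of `f` at `a w`. -/
def shift (a : σ) (f : NCPowerSeries σ) : NCPowerSeries σ := ⟨fun w => f.coeff (a :: w)⟩

theorem coeff_mul_nil (f g : NCPowerSeries σ) : (f * g).coeff [] = f.coeff [] * g.coeff [] := by
  simp [coeff_mul]

theorem coeff_mul_cons (f g : NCPowerSeries σ) (a : σ) (w : List σ) :
    (f * g).coeff (a :: w) = f.coeff [] * g.coeff (a :: w) + (shift a f * g).coeff w := by
  simp only [coeff_mul, List.length_cons, shift]
  rw [Finset.sum_range_succ' _ (w.length + 1), add_comm]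
  simp

protected theorem add_mul (f g h : NCPowerSeries σ) : (f + g) * h = f * h + g * h := by
  ext w
  simp only [coeff_mul, coeff_add, _root_.add_mul, Finset.sum_add_distrib]

protected theorem mul_add (f g h : NCPowerSeries σ) : f * (g + h) = f * g + f * h := by
  ext w
  simp only [coeff_mul, coeff_add, _root_.mul_add, Finset.sum_add_distrib]

protected theorem zero_mul (f : NCPowerSeries σ) : 0 * f = 0 := by
  ext w
  simp [coeff_mul]

protected theorem mul_zero (f : NCPowerSeries σ) : f * 0 = 0 := by
  ext w
  simp [coeff_mul]

protected theorem one_mul (f : NCPowerSeries σ) : 1 * f = f := by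
  ext w
  cases w with
  | nil => simp [coeff_mul_nil]
  | cons a w =>
    have h : shift a (1 : NCPowerSeries σ) = 0 := by
      ext v
      simp [shift]
    rw [coeff_mul_cons, h, NCPowerSeries.zero_mul]
    simp

protected theorem mul_one (f : NCPowerSeries σ) : f * 1 = f := by
  ext w
  induction w generalizing f with
  | nil => simp [coeff_mul_nil]
  | cons a w ih =>
    rw [coeff_mul_cons, ih]
    simp [shift]

protected theorem mul_assoc (f g h : NCPowerSeries σ) : f * g * h = f * (g * h) := by
  ext w
  induction w generalizing f with
  | nil => simp [coeff_mul_nil, _root_.mul_assoc]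
  | cons a w ih =>
    have hs : shift a (f * g) = ⟨fun w => f.coeff [] * (shift a g).coeff w⟩ + shift a f * g := by
      ext v
      simp [shift, coeff_mul_cons]
    have hc : ((⟨fun w => f.coeff [] * (shift a g).coeff w⟩ : NCPowerSeries σ) * h).coeff w
        = f.coeff [] * (shift a g * h).coeff w := by
      simp [coeff_mul, Finset.mul_sum, _root_.mul_assoc]
    rw [coeff_mul_cons, coeff_mul_cons, hs, NCPowerSeries.add_mul, coeff_add, ih, coeff_mul_nil,
      hc, coeff_mul_cons]
    ring

instance : Ring (NCPowerSeries σ) where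
  add_assoc f g h := by ext w; simp [add_assoc]
  zero_add f := by ext w; simp
  add_zero f := by ext w; simp
  add_comm f g := by ext w; simp [add_comm]
  neg_add_cancel f := by ext w; simp
  left_distrib := NCPowerSeries.mul_add
  right_distrib := NCPowerSeries.add_mul
  zero_mul := NCPowerSeries.zero_mul
  mul_zero := NCPowerSeries.mul_zero
  mul_assoc := NCPowerSeries.mul_assoc
  one_mul := NCPowerSeries.one_mul
  mul_one := NCPowerSeries.mul_one
  zsmul := zsmulRec
  nsmul := nsmulRec

variable [DecidableEq σ]

/-- The variable `X_i`. -/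
def X (i : σ) : NCPowerSeries σ := ⟨fun w => if w = [i] then 1 else 0⟩

/-- The series `1 - X_i + X_i² - X_i³ + ⋯`. -/
def invOneAddX (i : σ) : NCPowerSeries σ :=
  ⟨fun w => if ∀ a ∈ w, a = i then (-1) ^ w.length else 0⟩

theorem one_add_X_mul_inv (i : σ) : (1 + X i) * invOneAddX i = 1 := by
  ext w
  cases w with
  | nil => simp [coeff_mul_nil, X, invOneAddX]
  | cons a w =>
    by_cases ha : a = i
    · subst ha
      have h : shift a (1 + X a) = 1 := by
        ext v
        simp [shift, X]
      rw [coeff_mul_cons, h, one_mul]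
      by_cases hw : ∀ b ∈ w, b = a
      · have hw' : ∀ b ∈ a :: w, b = a := by simpa using hw
        simp only [invOneAddX, if_pos hw, if_pos hw']
        simp [X, pow_succ]
      · have hw' : ¬ ∀ b ∈ a :: w, b = a := by simpa using hw
        simp only [invOneAddX, if_neg hw, if_neg hw']
        simp
    · have h : shift a (1 + X i) = 0 := by
        ext v
        simp [shift, X, ha]
      rw [coeff_mul_cons, h, zero_mul]
      simp [invOneAddX, ha]

theorem inv_mul_one_add_X (i : σ) : invOneAddX i * (1 + X i) = 1 := by
  ext w
  induction w with
  | nil => simp [coeff_mul_nil, X, invOneAddX]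
  | cons a w ih =>
    by_cases ha : a = i
    · subst ha
      have h : shift a (invOneAddX a) = -invOneAddX a := by
        ext v
        by_cases hv : ∀ b ∈ v, b = a
        · have hv' : ∀ b ∈ a :: v, b = a := by simpa using hv
          simp only [shift, coeff_neg, invOneAddX, if_pos hv, if_pos hv']
          simp [pow_succ]
        · have hv' : ¬ ∀ b ∈ a :: v, b = a := by simpa using hv
          simp only [shift, coeff_neg, invOneAddX, if_neg hv, if_neg hv']
          simp
      rw [coeff_mul_cons, h, neg_mul, coeff_neg, ih]
      simp [X, invOneAddX]
    · have h : shift a (invOneAddX i) = 0 := by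
        ext v
        simp [shift, invOneAddX, ha]
      rw [coeff_mul_cons, h, zero_mul]
      simp [X, ha]

/-- `1 + X_i` as a unit, with inverse `1 - X_i + X_i² - ⋯`. -/
def unitOneAddX (i : σ) : (NCPowerSeries σ)ˣ where
  val := 1 + X i
  inv := invOneAddX i
  val_inv := one_add_X_mul_inv i
  inv_val := inv_mul_one_add_X i

end NCPowerSeries

/-- The Magnus expansion `E`, the homomorphism with `E(α_i) = 1 + X_i` and
`E(α_i⁻¹) = 1 - X_i + X_i² - ⋯`. -/
def magnusExpansion (n : ℕ) : FreeGroup (Fin n) →* (NCPowerSeries (Fin n))ˣ :=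
  FreeGroup.lift NCPowerSeries.unitOneAddX

/-! ### Milnor numbers from the sequence of arcs -/

/-- The record of the under-crossings met along each component of a diagram with base points.
Going along component `i` from its base point, one meets `m i` classical under-crossings, which
together with the base point cut the component into the `m i + 1` arcs `(i, 0), …, (i, m i)`.
The under-crossing `j` lies between the arcs `(i, j)` and `(i, j + 1)`; its over-strand belongs to
the arc `overArc i j` and its sign is `sign i j`. -/
structure ArcData (n : ℕ) where
  m : Fin n → ℕ
  overArc : (i : Fin n) → Fin (m i) → (Σ k : Fin n, Fin (m k + 1))
  sign : (i : Fin n) → Fin (m i) → ℤ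

namespace ArcData

variable {n : ℕ} (A : ArcData n)

/-- The set of arcs. -/
abbrev Arc : Type := Σ k : Fin n, Fin (A.m k + 1)

/-- The partial longitude: the product of the first `j` factors `u^ε` met along component `i`. -/
def partialLongitude (i : Fin n) (j : ℕ) : FreeGroup A.Arc :=
  ((List.finRange (A.m i)).take j |>.map
    fun r => FreeGroup.of (A.overArc i r) ^ A.sign i r).prod

/-- The homomorphisms `η_q` from the free group on the arcs to the free group on
`α_0, …, α_{n-1}`, for `q ≥ 1`: here `η_{q+1}` sends the arc `(i, j)` to
`η_q(v)⁻¹ α_i η_q(v)` with `v` the partial longitude up to that arc (the empty word if `j = 0`).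
The auxiliary `η_0` is trivial, which makes `η_1` send `(i, j)` to `α_i`. -/
def eta : ℕ → FreeGroup A.Arc →* FreeGroup (Fin n)
  | 0 => 1
  | q + 1 => FreeGroup.lift fun a =>
      (eta q (A.partialLongitude a.1 a.2))⁻¹ * FreeGroup.of a.1 *
        eta q (A.partialLongitude a.1 a.2)

theorem eta_one (a : A.Arc) : A.eta 1 (FreeGroup.of a) = FreeGroup.of a.1 := by
  simp [eta]

theorem eta_succ_first (q : ℕ) (i : Fin n) :
    A.eta (q + 1) (FreeGroup.of ⟨i, 0⟩) = FreeGroup.of i := by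
  simp [eta, partialLongitude]

theorem eta_succ (q : ℕ) (a : A.Arc) :
    A.eta (q + 1) (FreeGroup.of a) =
      (A.eta q (A.partialLongitude a.1 a.2))⁻¹ * FreeGroup.of a.1 *
        A.eta q (A.partialLongitude a.1 a.2) := by
  simp [eta]

/-- The sum of the signs of the classical self-crossings of component `i`; each of them is met
exactly once along component `i` as an under-crossing, namely one whose over-arc is on `i`. -/
def selfWrithe (i : Fin n) : ℤ :=
  ∑ j : Fin (A.m i), if (A.overArc i j).1 = i then A.sign i j else 0

/-- The preferred longitude of component `i`. -/
def preferredLongitude (i : Fin n) : FreeGroup A.Arc :=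
  FreeGroup.of ⟨i, 0⟩ ^ (-A.selfWrithe i) * A.partialLongitude i (A.m i)

/-- The number `μ^{(q)}(j₁ … jₛ i)`, where `J = [j₁, …, jₛ]`. -/
def milnorNumberAt (q : ℕ) (J : List (Fin n)) (i : Fin n) : ℤ :=
  (magnusExpansion n (A.eta q (A.preferredLongitude i))).val.coeff J

end ArcData

/-! ### Virtual link diagrams -/

/-- The determinant of two vectors of the oriented plane. -/
def planeDet (u v : ℝ × ℝ) : ℝ := u.1 * v.2 - u.2 * v.1

/-- The disjoint union of `n` ordered oriented circles `ℝ / ℤ`: a point is a pair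
(component, parameter). -/
abbrev CirclePoint (n : ℕ) : Type := Fin n × UnitAddCircle

/-- The velocity vector of a map from the circles to the plane. -/
noncomputable def curveVelocity {n : ℕ} (f : CirclePoint n → ℝ × ℝ) (P : CirclePoint n) : ℝ × ℝ :=
  deriv (fun t : ℝ => f (P.1, P.2 + (t : UnitAddCircle))) 0

/-- An `n`-component virtual link diagram: a smooth immersion of `n` ordered oriented circles
into the plane whose only singularities are transverse double points, each of which is either a
classical or a virtual crossing. A classical crossing is recorded as the pair
(over-passage, under-passage) of the two preimages of the double point; the double points not
recorded in either order are the virtual crossings. (There are only finitely many double points,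
since they are transverse and the circles are compact.) -/
structure VirtualLinkDiagram (n : ℕ) where
  curve : CirclePoint n → ℝ × ℝ
  smooth : ∀ i, ContDiff ℝ ∞ fun t : ℝ => curve (i, (t : UnitAddCircle))
  immersion : ∀ P, curveVelocity curve P ≠ 0
  no_triple : ∀ P Q R, curve P = curve Q → curve Q = curve R → P = Q ∨ Q = R ∨ P = R
  transverse : ∀ P Q, P ≠ Q → curve P = curve Q →
    planeDet (curveVelocity curve P) (curveVelocity curve Q) ≠ 0
  classical : Finset (CirclePoint n × CirclePoint n)
  classical_double : ∀ c ∈ classical, c.1 ≠ c.2 ∧ curve c.1 = curve c.2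
  classical_asymm : ∀ c ∈ classical, c.swap ∉ classical

/-- A virtual link diagram with a base point system: one base point on each component, away from
all classical and virtual crossings. -/
structure BasedDiagram (n : ℕ) extends VirtualLinkDiagram n where
  base : Fin n → UnitAddCircle
  base_not_crossing : ∀ i P, curve P = curve (i, base i) → P = (i, base i)

namespace VirtualLinkDiagram

variable {n : ℕ} (D : VirtualLinkDiagram n)

/-- The sign of a classical crossing: `+1` if the direction of the over-strand followed by the
direction of the under-strand is a positive basis of the plane, `-1` if it is a negative one. -/
noncomputable def crossingSign (c : CirclePoint n × CirclePoint n) : ℤ :=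
  SignType.sign (planeDet (curveVelocity D.curve c.1) (curveVelocity D.curve c.2))

end VirtualLinkDiagram

namespace BasedDiagram

variable {n : ℕ} (D : BasedDiagram n)

/-- The parameter in `[0, 1)` needed to reach a point from the base point of its component,
travelling along the orientation. -/
noncomputable def position (P : CirclePoint n) : ℝ :=
  (AddCircle.equivIco (1 : ℝ) 0 (P.2 - D.base P.1) : ℝ)

open Classical in
/-- The positions of the classical under-crossings on component `i`. -/
noncomputable def underPositions (i : Fin n) : Finset ℝ :=
  (D.classical.filter fun c => c.2.1 = i).image fun c => D.position c.2

theorem exists_crossing (i : Fin n) (j : Fin (D.underPositions i).card) :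
    ∃ c ∈ D.classical, c.2.1 = i ∧
      D.position c.2 = (D.underPositions i).orderEmbOfFin rfl j := by
  have h := (D.underPositions i).orderEmbOfFin_mem rfl j
  simp only [underPositions, Finset.mem_image, Finset.mem_filter] at h
  obtain ⟨c, ⟨h1, h2⟩, h3⟩ := h
  exact ⟨c, h1, h2, h3⟩

/-- The classical crossing that is the `j`-th under-crossing met along component `i` from its base
point (there is exactly one). -/
noncomputable def crossing (i : Fin n) (j : Fin (D.underPositions i).card) :
    CirclePoint n × CirclePoint n :=
  (D.exists_crossing i j).choose

open Classical in
/-- The arc on which a point lies (for a point that is neither a base point nor an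
under-crossing). -/
noncomputable def arcAt (P : CirclePoint n) :
    Σ k : Fin n, Fin ((D.underPositions k).card + 1) :=
  ⟨P.1, ⟨((D.underPositions P.1).filter fun t => t < D.position P).card,
    Nat.lt_succ_of_le (Finset.card_filter_le _ _)⟩⟩

/-- The sequence of arcs of a diagram with base points. -/
noncomputable def arcData : ArcData n where
  m i := (D.underPositions i).card
  overArc i j := D.arcAt (D.crossing i j).1
  sign i j := D.crossingSign (D.crossing i j)

/-- The number `μ^{(q)}_{(D,p)}(j₁ … jₛ i)`, where `J = [j₁, …, jₛ]`. -/
noncomputable def milnorNumberAt (q : ℕ) (J : List (Fin n)) (i : Fin n) : ℤ :=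
  D.arcData.milnorNumberAt q J i

/-- The Milnor number `μ_{(D,p)}(j₁ … jₛ i)`: the number `μ^{(q)}_{(D,p)}(j₁ … jₛ i)` for `q > s`,
taken here at `q = s + 1`. -/
noncomputable def milnorNumber (J : List (Fin n)) (i : Fin n) : ℤ :=
  D.milnorNumberAt (J.length + 1) J i

open Classical in
/-- The diagram in which the double point of `c` has been made virtual; nothing else changes. -/
noncomputable def virtualize (c : CirclePoint n × CirclePoint n) :
    BasedDiagram n :=
  { D with
    classical := D.classical.erase c
    classical_double := fun d hd => D.classical_double d (Finset.mem_of_mem_erase hd)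
    classical_asymm := fun d hd hs =>
      D.classical_asymm d (Finset.mem_of_mem_erase hd) (Finset.mem_of_mem_erase hs) }

/-- `D` and `D'` are the same diagram with base points, up to an orientation-preserving
diffeomorphism `Ψ` of the plane (equivalently, up to isotopy of the plane) and up to
orientation-preserving reparametrizations of the circles, whose lifts to `ℝ` are the `φ i`. -/
def SamePicture (D D' : BasedDiagram n) : Prop :=
  ∃ (Ψ : ℝ × ℝ → ℝ × ℝ) (φ : Fin n → ℝ → ℝ),
    (Function.Bijective Ψ ∧ ContDiff ℝ ∞ Ψ ∧ ∀ z, 0 < (fderiv ℝ Ψ z).det) ∧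
    (∀ i, ContDiff ℝ ∞ (φ i) ∧ (∀ t, 0 < deriv (φ i) t) ∧ ∀ t, φ i (t + 1) = φ i t + 1) ∧
    (∀ i (t : ℝ), D'.curve (i, t) = Ψ (D.curve (i, (φ i t : ℝ)))) ∧
    (∀ i (t : ℝ), D'.base i = t ↔ D.base i = (φ i t : ℝ)) ∧
    (∀ i j (s t : ℝ), ((i, (s : UnitAddCircle)), (j, (t : UnitAddCircle))) ∈ D'.classical ↔
      ((i, (φ i s : UnitAddCircle)), (j, (φ j t : UnitAddCircle))) ∈ D.classical)

/-- `D'` is obtained from `D` by one self-crossing virtualization: a classical crossing of a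
component of `D` with itself is replaced by a virtual crossing. -/
def SelfCrossingVirtualization (D D' : BasedDiagram n) : Prop :=
  ∃ c ∈ D.classical, c.1.1 = c.2.1 ∧ SamePicture (D.virtualize c) D'

end BasedDiagram

/-! Independence of q is a degree count. Since E(v⁻¹αv) = 1 + E(v)⁻¹ X E(v), agreement of `eta q`
and `eta (q + 1)` up to degree q improves by one degree at each step
(`coeff_magnusExpansion_eta_succ`).

For invariance, only coefficients at words without repetitions that avoid i matter. Such words are
closed under taking initial and final segments, so they define a quotient ring. There X_k f X_k = 0
for every f, so 1 + X_k commutes with all its conjugates, and X_i = 0, so α_i becomes 1. A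
self-crossing of component k contributes a power of a conjugate of α_k, and only to partial
longitudes of component k. These enter the meridians only through conjugation of α_k, which does not
see that factor (`conj_mul_zpow_conj_mul`); hence no meridian changes (`meridian_virtualize`). In
the longitude of component i itself, the deleted factor and the framing factor are both trivial
(`crossingProd_virtualize`, `lift_eta_preferredLongitude`).

Deleting a crossing renumbers the arcs, so `meridian` is indexed by points of the circles instead.
This also makes the comparison of diagrams with the same picture a transport along a map of points
(`PointCorrespondence`). -/

namespace NCPowerSeries

/-! ### Truncations of the power series ring -/

variable {σ : Type}

/-- Two series are congruent if their coefficients agree on a set of words that is closed under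
taking initial and final segments. -/
def agreeOn (S : Set (List σ)) (htake : ∀ w ∈ S, ∀ k, w.take k ∈ S)
    (hdrop : ∀ w ∈ S, ∀ k, w.drop k ∈ S) : RingCon (NCPowerSeries σ) where
  r f g := ∀ w ∈ S, f.coeff w = g.coeff w
  iseqv := ⟨fun _ _ _ => rfl, fun h w hw => (h w hw).symm,
    fun h h' w hw => (h w hw).trans (h' w hw)⟩
  add' h h' w hw := by simp only [coeff_add, h w hw, h' w hw]
  mul' h h' w hw := by
    simp only [coeff_mul]
    exact Finset.sum_congr rfl fun k _ => by rw [h _ (htake w hw k), h' _ (hdrop w hw k)]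

theorem agreeOn_coe_eq {S : Set (List σ)} {htake : ∀ w ∈ S, ∀ k, w.take k ∈ S}
    {hdrop : ∀ w ∈ S, ∀ k, w.drop k ∈ S} {f g : NCPowerSeries σ} :
    (agreeOn S htake hdrop).mk' f = (agreeOn S htake hdrop).mk' g ↔
      ∀ w ∈ S, f.coeff w = g.coeff w :=
  RingCon.eq _

/-- Congruence of series up to degree `d`. -/
def agreeUpTo (σ : Type) (d : ℕ) : RingCon (NCPowerSeries σ) :=
  agreeOn {w | w.length ≤ d} (fun _ hw _ => (List.length_take_le' _ _).trans hw)
    fun _ hw _ => List.length_drop.trans_le ((Nat.sub_le _ _).trans hw)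

/-- Congruence of series on the words without repeated letters that avoid the letter `i`. -/
def agreeOnNodup (i : σ) : RingCon (NCPowerSeries σ) :=
  agreeOn {w | w.Nodup ∧ i ∉ w}
    (fun _ hw _ => ⟨hw.1.sublist (List.take_sublist _ _), fun h => hw.2 (List.mem_of_mem_take h)⟩)
    fun _ hw _ => ⟨hw.1.sublist (List.drop_sublist _ _), fun h => hw.2 (List.mem_of_mem_drop h)⟩

theorem agreeUpTo_coe_eq {d : ℕ} {f g : NCPowerSeries σ} :
    (agreeUpTo σ d).mk' f = (agreeUpTo σ d).mk' g ↔ ∀ w, w.length ≤ d → f.coeff w = g.coeff w :=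
  agreeOn_coe_eq

theorem agreeOnNodup_coe_eq {i : σ} {f g : NCPowerSeries σ} :
    (agreeOnNodup i).mk' f = (agreeOnNodup i).mk' g ↔
      ∀ w, w.Nodup → i ∉ w → f.coeff w = g.coeff w :=
  agreeOn_coe_eq.trans (by simp)

theorem units_map_agreeUpTo_eq {d : ℕ} {f g : (NCPowerSeries σ)ˣ} :
    Units.map (agreeUpTo σ d).mk'.toMonoidHom f = Units.map (agreeUpTo σ d).mk'.toMonoidHom g ↔
      ∀ w, w.length ≤ d → f.val.coeff w = g.val.coeff w :=
  Units.ext_iff.trans agreeUpTo_coe_eq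

theorem units_map_agreeOnNodup_eq {i : σ} {f g : (NCPowerSeries σ)ˣ} :
    Units.map (agreeOnNodup i).mk'.toMonoidHom f = Units.map (agreeOnNodup i).mk'.toMonoidHom g ↔
      ∀ w, w.Nodup → i ∉ w → f.val.coeff w = g.val.coeff w :=
  Units.ext_iff.trans agreeOnNodup_coe_eq

variable [DecidableEq σ]

theorem coeff_X_mul_nil (i : σ) (f : NCPowerSeries σ) : (X i * f).coeff [] = 0 := by
  simp [coeff_mul_nil, X]

theorem coeff_X_mul_cons (i a : σ) (f : NCPowerSeries σ) (w : List σ) :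
    (X i * f).coeff (a :: w) = if a = i then f.coeff w else 0 := by
  rw [coeff_mul_cons]
  split_ifs with h
  · have : shift a (X i) = 1 := by ext v; simp [shift, X, h]
    rw [this, one_mul]
    simp [X]
  · have : shift a (X i) = 0 := by ext v; simp [shift, X, h]
    rw [this, zero_mul]
    simp [X]

theorem coeff_mul_X_of_notMem {i : σ} (f : NCPowerSeries σ) {w : List σ} (hw : i ∉ w) :
    (f * X i).coeff w = 0 := by
  rw [coeff_mul]
  refine Finset.sum_eq_zero fun k _ => ?_
  have : w.drop k ≠ [i] := fun h => hw (List.mem_of_mem_drop (h ▸ List.mem_singleton_self i))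
  simp [X, this]

/-- Every monomial of the product begins and ends with its own copy of the letter i. This is the
relation that makes conjugates of a meridian commute. -/
theorem coeff_X_mul_X_of_nodup (i : σ) (f : NCPowerSeries σ) {w : List σ} (hw : w.Nodup) :
    (X i * f * X i).coeff w = 0 := by
  rw [mul_assoc]
  cases w with
  | nil => exact coeff_X_mul_nil _ _
  | cons a w =>
    rw [coeff_X_mul_cons]
    split_ifs with h
    · exact coeff_mul_X_of_notMem f (h ▸ (List.nodup_cons.1 hw).1)
    · rfl

/-- Multiplying by a variable raises by one the degree up to which two series agree. -/
theorem coeff_mul_X_mul_congr {d : ℕ} {f f' g g' : NCPowerSeries σ} (i : σ)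
    (hf : ∀ w, w.length ≤ d → f.coeff w = f'.coeff w)
    (hg : ∀ w, w.length ≤ d → g.coeff w = g'.coeff w) (w : List σ) (hw : w.length ≤ d + 1) :
    (f * (X i * g)).coeff w = (f' * (X i * g')).coeff w := by
  have hX : ∀ v : List σ, v.length ≤ d + 1 → (X i * g).coeff v = (X i * g').coeff v := by
    intro v hv
    cases v with
    | nil => simp only [coeff_X_mul_nil]
    | cons a v => rw [coeff_X_mul_cons, coeff_X_mul_cons, hg v (by simpa using hv)]
  simp only [coeff_mul f, coeff_mul f']
  refine Finset.sum_congr rfl fun k _ => ?_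
  rw [hX _ (List.length_drop.trans_le ((Nat.sub_le _ _).trans hw))]
  -- A full-length prefix may have length d + 1, beyond the reach of `hf`; it is paired with the
  -- constant term of a multiple of X_i, which is 0.
  by_cases hk : k < w.length
  · rw [hf _ (by rw [List.length_take]; omega)]
  · rw [List.drop_eq_nil_of_le (by omega), coeff_X_mul_nil, mul_zero, mul_zero]

/-- The image of `1 + X_k` among the units of the quotient by `agreeOnNodup i`. -/
def nodupMeridian (i k : σ) : ((agreeOnNodup i).Quotient)ˣ :=
  Units.map (agreeOnNodup i).mk'.toMonoidHom (unitOneAddX k)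

theorem nodupMeridian_self (i : σ) : nodupMeridian i i = 1 := by
  rw [nodupMeridian, ← map_one (Units.map (agreeOnNodup i).mk'.toMonoidHom),
    units_map_agreeOnNodup_eq]
  intro w _ hw
  have : w ≠ [i] := fun h => hw (h ▸ List.mem_singleton_self i)
  simp [unitOneAddX, X, this]

end NCPowerSeries

/-! ### Elements that commute with all their conjugates -/

/-- The conjugate is 1 + g⁻¹xg, and both products of x with g⁻¹xg contain a factor of the form x f
x. -/
theorem commute_conj_one_add {R : Type*} [Ring R] {x : R} (hx : ∀ f, x * f * x = 0) {u : Rˣ}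
    (hu : u.val = 1 + x) (g : Rˣ) : Commute u (g⁻¹ * u * g) := by
  have h1 : ((g⁻¹ * u * g : Rˣ) : R) = 1 + ↑g⁻¹ * x * g := by
    simp [hu, mul_add, add_mul]
  rw [commute_iff_eq, Units.ext_iff, Units.val_mul u, Units.val_mul _ u, h1, hu]
  have h2 : x * (↑g⁻¹ * x * ↑g) = 0 := by
    rw [← mul_assoc, ← mul_assoc, hx, zero_mul]
  have h3 : ↑g⁻¹ * x * ↑g * x = 0 := by
    rw [mul_assoc (↑g⁻¹ : R), mul_assoc (↑g⁻¹ : R), hx, mul_zero]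
  simp only [mul_add, add_mul, mul_one, one_mul, h2, h3]
  abel

theorem NCPowerSeries.commute_conj_nodupMeridian {σ : Type} [DecidableEq σ] (i k : σ)
    (g : ((agreeOnNodup i).Quotient)ˣ) :
    Commute (nodupMeridian i k) (g⁻¹ * nodupMeridian i k * g) := by
  refine commute_conj_one_add (x := (agreeOnNodup i).mk' (X k)) (fun f => ?_) ?_ g
  · obtain ⟨f, rfl⟩ := RingCon.mk'_surjective _ f
    rw [← map_mul, ← map_mul, ← map_zero (agreeOnNodup i).mk', agreeOnNodup_coe_eq]
    exact fun w hw _ => coeff_X_mul_X_of_nodup k f hw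
  · simp [nodupMeridian, unitOneAddX]

section Conjugation

variable {G : Type*} [Group G]

/-- If all conjugates of `a` commute, conjugating `a` by a product is not affected by deleting from
the product a power of a conjugate of `a`. -/
theorem conj_mul_zpow_conj_mul {a : G} (ha : ∀ g, Commute a (g⁻¹ * a * g)) (x y g : G) (e : ℤ) :
    (x * (g⁻¹ * a * g) ^ e * y)⁻¹ * a * (x * (g⁻¹ * a * g) ^ e * y) =
      (x * y)⁻¹ * a * (x * y) := by
  have h : Commute (x⁻¹ * a * x) (g⁻¹ * a * g) := by
    -- The conjugator g x⁻¹ is chosen so that conjugating further by x leaves g⁻¹ag.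
    have := (Commute.conj_iff (x⁻¹)).2 (ha (g * x⁻¹))
    convert this using 1 <;> group
  have h' := (h.zpow_right e).eq
  calc _ = y⁻¹ * (((g⁻¹ * a * g) ^ e)⁻¹ * ((x⁻¹ * a * x) * (g⁻¹ * a * g) ^ e)) * y := by
        simp only [mul_inv_rev, mul_assoc]
    _ = _ := by rw [h', inv_mul_cancel_left]; simp only [mul_inv_rev, mul_assoc]

end Conjugation

/-! ### Independence of q -/

namespace ArcData

variable {n : ℕ} (A : ArcData n)

theorem magnusExpansion_of (i : Fin n) :
    magnusExpansion n (FreeGroup.of i) = NCPowerSeries.unitOneAddX i := by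
  simp [magnusExpansion]

open NCPowerSeries in
/-- `η_q` and `η_{q+1}` agree up to degree `q` after Magnus expansion. -/
theorem coeff_magnusExpansion_eta_succ (q : ℕ) (x : FreeGroup A.Arc) (w : List (Fin n))
    (hw : w.length ≤ q) :
    (magnusExpansion n (A.eta (q + 1) x)).val.coeff w =
      (magnusExpansion n (A.eta q x)).val.coeff w := by
  let M := fun d => (Units.map (agreeUpTo (Fin n) d).mk'.toMonoidHom).comp (magnusExpansion n)
  suffices h : (M q).comp (A.eta (q + 1)) = (M q).comp (A.eta q) from
    units_map_agreeUpTo_eq.1 (DFunLike.congr_fun h x) w hw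
  clear x w hw
  induction q with
  | zero =>
    ext1 a
    -- The trivial `eta 0` is a valid start because 1 + X has constant term 1.
    have h0 : M 0 (FreeGroup.of a.1) = 1 := by
      refine (units_map_agreeUpTo_eq (g := 1)).2 fun w hw => ?_
      obtain rfl := List.length_eq_zero_iff.1 (Nat.le_zero.1 hw)
      simp [magnusExpansion_of, unitOneAddX, X]
    simp [h0, eta]
  | succ q ih =>
    ext1 a
    set v := A.partialLongitude a.1 a.2
    have hv : ∀ y, ∀ w : List (Fin n), w.length ≤ q →
        (magnusExpansion n (A.eta (q + 1) y)).val.coeff w =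
          (magnusExpansion n (A.eta q y)).val.coeff w := fun y =>
      units_map_agreeUpTo_eq.1 (DFunLike.congr_fun ih y)
    -- Isolating the factor X is what gains the extra degree.
    have key : ∀ q, (magnusExpansion n (A.eta (q + 1) (FreeGroup.of a))).val =
        1 + (magnusExpansion n (A.eta q v⁻¹)).val *
          (X a.1 * (magnusExpansion n (A.eta q v)).val) := by
      intro q
      rw [eta_succ, map_mul, map_mul, magnusExpansion_of, Units.val_mul, Units.val_mul, map_inv,
        map_inv, map_inv]
      simp only [unitOneAddX, mul_add, add_mul, mul_one, Units.inv_mul, mul_assoc, v]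
    refine units_map_agreeUpTo_eq.2 fun w hw => ?_
    rw [key, key, coeff_add, coeff_add,
      coeff_mul_X_mul_congr a.1 (hv v⁻¹) (hv v) w hw]

theorem milnorNumberAt_succ {q : ℕ} {J : List (Fin n)} (i : Fin n) (h : J.length ≤ q) :
    A.milnorNumberAt (q + 1) J i = A.milnorNumberAt q J i :=
  A.coeff_magnusExpansion_eta_succ q _ J h

theorem milnorNumberAt_eq {q : ℕ} {J : List (Fin n)} (i : Fin n) (h : J.length < q) :
    A.milnorNumberAt q J i = A.milnorNumberAt (J.length + 1) J i := by
  induction q, h using Nat.le_induction with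
  | base => rfl
  | succ q hq ih => rw [A.milnorNumberAt_succ i (by omega), ih]

end ArcData

/-! ### Strictly sorted lists -/

/-- In a list along which `f` increases strictly, the entries with `f x < s` form an initial
segment. -/
theorem List.take_countP_lt_eq_filter {α β : Type*} [LinearOrder β] (f : α → β) (s : β)
    (l : List α) (hl : l.Pairwise fun x y => f x < f y) :
    l.take (l.countP fun x => f x < s) = l.filter fun x => f x < s := by
  induction l with
  | nil => rfl
  | cons x l ih =>
    rw [List.pairwise_cons] at hl
    by_cases hx : f x < s
    · simp [hx, ih hl.2]
    · have : ∀ y ∈ l, ¬ f y < s := fun y hy h => hx ((hl.1 y hy).trans h)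
      have h0 : l.countP (fun x => f x < s) = 0 := by simpa [List.countP_eq_zero] using this
      have h1 : l.filter (fun x => f x < s) = [] := by simpa [List.filter_eq_nil_iff] using this
      simp [hx, h0, h1]

/-- Two lists with the same entries along which `f` increases strictly are equal. -/
theorem List.eq_of_pairwise_lt_of_mem_iff {α β : Type*} [LinearOrder β] (f : α → β)
    {l l' : List α} (hl : l.Pairwise fun x y => f x < f y)
    (hl' : l'.Pairwise fun x y => f x < f y) (h : ∀ x, x ∈ l ↔ x ∈ l') : l = l' := by
  have hn : ∀ {l : List α}, (l.Pairwise fun x y => f x < f y) → l.Nodup := fun h =>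
    h.imp fun h e => (e ▸ h).ne rfl
  exact ((List.perm_ext_iff_of_nodup (hn hl) (hn hl')).2 h).eq_of_pairwise
    (fun _ _ _ _ h h' => absurd h h'.asymm) hl hl'

theorem List.filter_ne_eq_self {α : Type*} [DecidableEq α] {c : α} {l : List α} (h : c ∉ l) :
    l.filter (· ≠ c) = l :=
  List.filter_eq_self.2 fun d hd => decide_eq_true fun e : d = c => h (e ▸ hd)

/-! ### From numbered arcs to points of the circles -/

namespace BasedDiagram

variable {n : ℕ} (D : BasedDiagram n)

theorem position_injective {P Q : CirclePoint n} (h1 : P.1 = Q.1)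
    (h2 : D.position P = D.position Q) : P = Q := by
  refine Prod.ext h1 ?_
  have := (AddCircle.equivIco (1 : ℝ) 0).injective (Subtype.ext h2)
  rw [h1] at this
  exact sub_left_injective this

theorem position_coe (i : Fin n) {s : ℝ} (hs : s ∈ Set.Ico (0 : ℝ) 1) :
    D.position (i, D.base i + (s : UnitAddCircle)) = s := by
  have : (s : UnitAddCircle) = (AddCircle.equivIco (1 : ℝ) 0).symm ⟨s, by simpa using hs⟩ := rfl
  simp [position, this]

theorem position_mem (P : CirclePoint n) : D.position P ∈ Set.Ico (0 : ℝ) 1 := by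
  have h : D.position P ∈ Set.Ico (0 : ℝ) (0 + 1) :=
    (AddCircle.equivIco (1 : ℝ) 0 (P.2 - D.base P.1)).2
  rwa [zero_add] at h

theorem base_add_position (P : CirclePoint n) :
    D.base P.1 + (D.position P : UnitAddCircle) = P.2 := by
  have := (AddCircle.equivIco (1 : ℝ) 0).symm_apply_apply (P.2 - D.base P.1)
  exact (eq_sub_iff_add_eq'.1 this)

/-- The classical under-crossings on component `i` in the order in which they are met. -/
noncomputable def underCrossings (i : Fin n) : List (CirclePoint n × CirclePoint n) :=
  (List.finRange (D.underPositions i).card).map (D.crossing i)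

theorem position_crossing (i : Fin n) (j : Fin (D.underPositions i).card) :
    D.position (D.crossing i j).2 = (D.underPositions i).orderEmbOfFin rfl j :=
  (D.exists_crossing i j).choose_spec.2.2

/-- Two distinct over-passages above one under-passage would give a triple point. -/
theorem classical_ext {c d : CirclePoint n × CirclePoint n} (hc : c ∈ D.classical)
    (hd : d ∈ D.classical) (h : c.2 = d.2) : c = d := by
  have hc' := D.classical_double c hc
  have hd' := D.classical_double d hd
  refine Prod.ext ?_ h
  rcases D.no_triple c.1 c.2 d.1 hc'.2 (h ▸ hd'.2.symm) with h' | h' | h'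
  · exact absurd h' hc'.1
  · exact absurd (h'.symm.trans h) hd'.1
  · exact h'

theorem mem_underCrossings {i : Fin n} {c : CirclePoint n × CirclePoint n} :
    c ∈ D.underCrossings i ↔ c ∈ D.classical ∧ c.2.1 = i := by
  constructor
  · intro h
    obtain ⟨j, -, rfl⟩ := List.mem_map.1 h
    have h := (D.exists_crossing i j).choose_spec
    exact ⟨h.1, h.2.1⟩
  · rintro ⟨hc, hi⟩
    have hp : D.position c.2 ∈ D.underPositions i := by
      simp only [underPositions, Finset.mem_image, Finset.mem_filter]
      exact ⟨c, ⟨hc, hi⟩, rfl⟩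
    rw [← Finset.mem_coe, ← Finset.range_orderEmbOfFin (D.underPositions i) rfl] at hp
    obtain ⟨j, hj⟩ := hp
    refine List.mem_map.2 ⟨j, List.mem_finRange j, ?_⟩
    have h := (D.exists_crossing i j).choose_spec
    exact D.classical_ext h.1 hc
      (D.position_injective (h.2.1.trans hi.symm) ((D.position_crossing i j).trans hj))

theorem underCrossings_pairwise (i : Fin n) :
    (D.underCrossings i).Pairwise fun c d => D.position c.2 < D.position d.2 := by
  refine List.pairwise_map.2 ((List.pairwise_lt_finRange _).imp fun h => ?_)
  simpa only [position_crossing, OrderEmbedding.lt_iff_lt] using h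

theorem countP_underCrossings (i : Fin n) (s : ℝ) :
    (D.underCrossings i).countP (fun c => D.position c.2 < s) =
      ((D.underPositions i).filter fun t => t < s).card := by
  have h : (D.underPositions i).sort (· ≤ ·) =
      (D.underCrossings i).map fun c => D.position c.2 := by
    rw [underCrossings, List.map_map, ← Finset.listMap_orderEmbOfFin_finRange _ rfl]
    exact List.map_congr_left fun j _ => (D.position_crossing i j).symm
  have hn := (D.underPositions i).sort_nodup (· ≤ ·)
  have hf : (D.underPositions i).filter (fun t => t < s) =
      (((D.underPositions i).sort (· ≤ ·)).filter fun t => t < s).toFinset := by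
    ext t
    simp
  rw [hf, List.toFinset_card_of_nodup (hn.filter _), h, ← List.countP_eq_length_filter,
    List.countP_map]
  rfl

/-- The arc on which a point lies, as an arc of the arc data. -/
noncomputable def pointArc (P : CirclePoint n) : D.arcData.Arc := D.arcAt P

section Meridian

variable {G : Type*} [Group G] (a : Fin n → G)

/-- The product of the factors `u^ε` over the crossings of a list, where the over-strand at `P`
contributes `g P`. -/
noncomputable def crossingProd (g : CirclePoint n → G)
    (l : List (CirclePoint n × CirclePoint n)) : G :=
  (l.map fun c => g c.1 ^ D.crossingSign c).prod

/-- The image in a group `G` of `η_q` of the arc at a point, when `α_i` is sent to `a i`. -/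
noncomputable def meridian : ℕ → CirclePoint n → G
  | 0, _ => 1
  | q + 1, P =>
    (D.crossingProd (meridian q)
      ((D.underCrossings P.1).filter fun c => D.position c.2 < D.position P))⁻¹ * a P.1 *
    D.crossingProd (meridian q)
      ((D.underCrossings P.1).filter fun c => D.position c.2 < D.position P)

theorem lift_eta_partialLongitude (q : ℕ) (i : Fin n) (j : ℕ) :
    FreeGroup.lift a (D.arcData.eta q (D.arcData.partialLongitude i j)) =
      D.crossingProd (fun P => FreeGroup.lift a (D.arcData.eta q (FreeGroup.of (D.pointArc P))))
        ((D.underCrossings i).take j) := by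
  simp only [ArcData.partialLongitude, crossingProd, underCrossings, map_list_prod, List.map_map,
    ← List.map_take]
  refine congrArg List.prod (List.map_congr_left fun r _ => ?_)
  simp only [Function.comp_apply, map_zpow]
  rfl

/-- The index of the arc at P is the number of under-crossings passed before P, so the first that
many under-crossings are exactly those positioned before P. -/
theorem lift_eta_pointArc (q : ℕ) (P : CirclePoint n) :
    FreeGroup.lift a (D.arcData.eta q (FreeGroup.of (D.pointArc P))) = D.meridian a q P := by
  induction q generalizing P with
  | zero => simp [ArcData.eta, meridian]
  | succ q ih =>
    have h : FreeGroup.lift a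
        (D.arcData.eta q (D.arcData.partialLongitude (D.pointArc P).1 (D.pointArc P).2)) =
        D.crossingProd (D.meridian a q)
          ((D.underCrossings P.1).filter fun c => D.position c.2 < D.position P) := by
      rw [lift_eta_partialLongitude, funext ih, ← List.take_countP_lt_eq_filter _ _ _
        (D.underCrossings_pairwise P.1), countP_underCrossings]
      congr
    rw [ArcData.eta_succ, map_mul, map_mul, map_inv, h, FreeGroup.lift_apply_of]
    rfl

/-- The first arc of component i maps to a i = 1, so the self-writhe disappears. -/
theorem lift_eta_preferredLongitude (q : ℕ) {i : Fin n} (ha : a i = 1) :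
    FreeGroup.lift a (D.arcData.eta q (D.arcData.preferredLongitude i)) =
      D.crossingProd (D.meridian a q) (D.underCrossings i) := by
  have h1 : FreeGroup.lift a (D.arcData.eta q (FreeGroup.of ⟨i, 0⟩)) = 1 := by
    cases q with
    | zero => simp [ArcData.eta]
    | succ q => simp [ArcData.eta_succ_first, ha]
  rw [ArcData.preferredLongitude, map_mul, map_mul, map_zpow, map_zpow, h1, one_zpow, one_mul,
    lift_eta_partialLongitude, List.take_of_length_le]
  · exact congrArg₂ D.crossingProd (funext fun P => D.lift_eta_pointArc a q P) rfl
  · simp [underCrossings, arcData]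

/-- A meridian is a conjugate of a generator, unless `q = 0`. -/
theorem exists_meridian_zpow_eq (q : ℕ) (P : CirclePoint n) (e : ℤ) :
    ∃ (g : G) (e' : ℤ), D.meridian a q P ^ e = (g⁻¹ * a P.1 * g) ^ e' := by
  cases q with
  | zero => exact ⟨1, 0, by simp [meridian]⟩
  | succ q => exact ⟨_, e, rfl⟩

end Meridian

/-! ### Effect of virtualizing a self-crossing -/

section Virtualize

variable {G : Type*} [Group G] (a : Fin n → G) (c : CirclePoint n × CirclePoint n)

-- Positions depend only on the base points, which virtualization keeps, so both lists are sorted by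
-- the same function and only membership has to be compared.
open Classical in
theorem underCrossings_virtualize (i : Fin n) :
    (D.virtualize c).underCrossings i = (D.underCrossings i).filter (· ≠ c) := by
  refine List.eq_of_pairwise_lt_of_mem_iff (fun d : CirclePoint n × CirclePoint n => D.position d.2)
    ((D.virtualize c).underCrossings_pairwise i) ((D.underCrossings_pairwise i).filter _) ?_
  intro d
  rw [mem_underCrossings, List.mem_filter, mem_underCrossings]
  simp [virtualize]
  tauto

variable {D c} {a}

open Classical in
/-- Deleting one self-crossing from a list of under-crossings on component `k` does not change the
effect of conjugation on `a k`. -/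
theorem conj_crossingProd_filter_ne (ha : ∀ k g, Commute (a k) (g⁻¹ * a k * g))
    (hc : c.1.1 = c.2.1) (q : ℕ) {k : Fin n} {l : List (CirclePoint n × CirclePoint n)}
    (hl : l.Nodup) (hk : ∀ d ∈ l, d.2.1 = k) :
    (D.crossingProd (D.meridian a q) (l.filter (· ≠ c)))⁻¹ * a k *
        D.crossingProd (D.meridian a q) (l.filter (· ≠ c)) =
      (D.crossingProd (D.meridian a q) l)⁻¹ * a k * D.crossingProd (D.meridian a q) l := by
  by_cases h : c ∈ l
  · obtain ⟨x, y, rfl⟩ := List.append_of_mem h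
    have hn : c ∉ x ∧ c ∉ y := by
      rw [List.nodup_middle, List.nodup_cons, List.mem_append, not_or] at hl
      exact hl.1
    obtain rfl := hk c h
    obtain ⟨g, e, he⟩ := D.exists_meridian_zpow_eq a q c.1 (D.crossingSign c)
    rw [List.filter_append, List.filter_cons_of_neg (by simp), List.filter_ne_eq_self hn.1,
      List.filter_ne_eq_self hn.2]
    simp only [crossingProd, List.map_append, List.map_cons, List.prod_append, List.prod_cons]
    rw [he, hc, ← mul_assoc (List.prod _) ((g⁻¹ * a c.2.1 * g) ^ e),
      conj_mul_zpow_conj_mul (ha c.2.1)]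
  · rw [List.filter_ne_eq_self h]

theorem underCrossings_nodup (i : Fin n) : (D.underCrossings i).Nodup :=
  (D.underCrossings_pairwise i).imp fun h e => (e ▸ h).ne rfl

theorem meridian_virtualize (ha : ∀ k g, Commute (a k) (g⁻¹ * a k * g)) (hc : c.1.1 = c.2.1)
    (q : ℕ) : (D.virtualize c).meridian a q = D.meridian a q := by
  classical
  induction q with
  | zero => rfl
  | succ q ih =>
    funext P
    simp only [meridian, ih, underCrossings_virtualize]
    -- Cutting at P is done before deleting c, so that a single list loses one crossing.
    rw [List.filter_comm]
    exact conj_crossingProd_filter_ne ha hc q ((D.underCrossings_nodup P.1).filter _)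
      fun d hd => (D.mem_underCrossings.1 (List.mem_of_mem_filter hd)).2

theorem crossingProd_virtualize (ha : ∀ k g, Commute (a k) (g⁻¹ * a k * g)) (hc : c.1.1 = c.2.1)
    (q : ℕ) {i : Fin n} (hi : a i = 1) :
    (D.virtualize c).crossingProd ((D.virtualize c).meridian a q)
        ((D.virtualize c).underCrossings i) =
      D.crossingProd (D.meridian a q) (D.underCrossings i) := by
  classical
  rw [meridian_virtualize ha hc, underCrossings_virtualize]
  -- Crossing signs depend on the curve alone, so they agree definitionally.
  change D.crossingProd _ _ = _
  by_cases h : c ∈ D.underCrossings i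
  · have hki := (D.mem_underCrossings.1 h).2
    obtain ⟨g, e, he⟩ := D.exists_meridian_zpow_eq a q c.1 (D.crossingSign c)
    -- The over-strand of c also lies on component i, so its factor is a power of a conjugate of a i
    -- = 1.
    rw [hc, hki, hi, mul_one, inv_mul_cancel, one_zpow] at he
    have h1 : ∀ l : List (CirclePoint n × CirclePoint n),
        D.crossingProd (D.meridian a q) (l.filter (· ≠ c)) =
          D.crossingProd (D.meridian a q) l := by
      intro l
      induction l with
      | nil => rfl
      | cons d l ih =>
        simp only [crossingProd] at ih ⊢
        by_cases hd : d = c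
        · rw [List.filter_cons_of_neg (by simpa using hd), ih, List.map_cons, List.prod_cons, hd,
            he, one_mul]
        · rw [List.filter_cons_of_pos (by simpa using hd), List.map_cons, List.map_cons,
            List.prod_cons, List.prod_cons, ih]
    exact h1 _
  · rw [List.filter_ne_eq_self h]

end Virtualize

end BasedDiagram

/-! ### Invariance under diffeomorphism and reparametrization -/

theorem planeDet_map (L : ℝ × ℝ →L[ℝ] ℝ × ℝ) (u v : ℝ × ℝ) :
    planeDet (L u) (L v) = L.det * planeDet u v := by
  have hL : ∀ w : ℝ × ℝ, L w = w.1 • L (1, 0) + w.2 • L (0, 1) := fun w => by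
    rw [← map_smul, ← map_smul, ← map_add]
    simp
  have hd : L.det = (L (1, 0)).1 * (L (0, 1)).2 - (L (0, 1)).1 * (L (1, 0)).2 := by
    rw [ContinuousLinearMap.det, ← LinearMap.det_toMatrix (Module.Basis.finTwoProd ℝ),
      Matrix.det_fin_two]
    simp [LinearMap.toMatrix_apply]
  rw [hL u, hL v, hd]
  simp only [planeDet, Prod.fst_add, Prod.snd_add, Prod.smul_fst, Prod.smul_snd, smul_eq_mul]
  ring

/-- A representative in `ℝ` of a point of the circle. -/
theorem UnitAddCircle.exists_coe_eq (x : UnitAddCircle) : ∃ t : ℝ, (t : UnitAddCircle) = x :=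
  QuotientAddGroup.mk_surjective x

section CircleMap

variable {φ : ℝ → ℝ}

theorem map_add_int_of_map_add_one (h : ∀ t, φ (t + 1) = φ t + 1) (t : ℝ) (m : ℤ) :
    φ (t + m) = φ t + m := by
  induction m using Int.induction_on with
  | zero => simp
  | succ m ih => rw [Int.cast_add, Int.cast_one, ← add_assoc, h, ih, add_assoc]
  | pred m ih =>
    have := h (t + ((-m - 1 : ℤ) : ℝ))
    rw [show t + ((-m - 1 : ℤ) : ℝ) + 1 = t + ((-m : ℤ) : ℝ) by push_cast; ring, ih] at this
    push_cast at this ⊢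
    linarith

/-- This is what lets a lift φ descend to a map of the circle. -/
theorem coe_map_eq_of_coe_eq (h : ∀ t, φ (t + 1) = φ t + 1) {s t : ℝ}
    (hst : (s : UnitAddCircle) = t) : (φ s : UnitAddCircle) = φ t := by
  rw [← sub_eq_zero, ← AddCircle.coe_sub, AddCircle.coe_eq_zero_iff] at hst ⊢
  obtain ⟨m, hm⟩ := hst
  refine ⟨m, ?_⟩
  rw [zsmul_one] at hm ⊢
  rw [show s = t + m by linarith, map_add_int_of_map_add_one h]
  ring

theorem surjective_of_map_add_one (hc : Continuous φ) (h : ∀ t, φ (t + 1) = φ t + 1) :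
    Function.Surjective φ := by
  intro y
  have h1 : φ (0 + (⌊y - φ 0⌋ : ℤ)) ≤ y := by
    rw [map_add_int_of_map_add_one h]
    linarith [Int.floor_le (y - φ 0)]
  have h2 : y ≤ φ (0 + (⌈y - φ 0⌉ : ℤ)) := by
    rw [map_add_int_of_map_add_one h]
    linarith [Int.le_ceil (y - φ 0)]
  exact mem_range_of_exists_le_of_exists_ge hc ⟨_, h1⟩ ⟨_, h2⟩

end CircleMap

namespace BasedDiagram

variable {n : ℕ} {D D' : BasedDiagram n}

theorem curveVelocity_eq_of_picture {Ψ : ℝ × ℝ → ℝ × ℝ} {φ : Fin n → ℝ → ℝ}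
    (hΨ : ContDiff ℝ ∞ Ψ) (hφ : ∀ i, ContDiff ℝ ∞ (φ i))
    (h : ∀ i (t : ℝ), D'.curve (i, t) = Ψ (D.curve (i, (φ i t : ℝ)))) (i : Fin n) (t : ℝ) :
    curveVelocity D'.curve (i, t) = deriv (φ i) t •
      fderiv ℝ Ψ (D.curve (i, (φ i t : ℝ))) (curveVelocity D.curve (i, (φ i t : ℝ))) := by
  have hD : Differentiable ℝ fun s : ℝ => D.curve (i, (s : UnitAddCircle)) :=
    (D.smooth i).differentiable (by simp)
  have hv : curveVelocity D.curve (i, (φ i t : ℝ)) =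
      deriv (fun s : ℝ => D.curve (i, (s : UnitAddCircle))) (φ i t) := by
    simp only [curveVelocity, ← AddCircle.coe_add]
    rw [deriv_comp_const_add (fun s : ℝ => D.curve (i, (s : UnitAddCircle))), add_zero]
  have hv' : curveVelocity D'.curve (i, t) =
      deriv (fun s : ℝ => D'.curve (i, (s : UnitAddCircle))) t := by
    simp only [curveVelocity, ← AddCircle.coe_add]
    rw [deriv_comp_const_add (fun s : ℝ => D'.curve (i, (s : UnitAddCircle))), add_zero]
  rw [hv, hv', funext (h i), ← map_smul]
  have h1 : HasDerivAt (φ i) (deriv (φ i) t) t :=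
    ((hφ i).differentiable (by simp) t).hasDerivAt
  have h2 := (hD (φ i t)).hasDerivAt.scomp t h1
  exact (((hΨ.differentiable (by simp) _).hasFDerivAt).comp_hasDerivAt t h2).deriv

/-- What two based diagrams with the same picture have in common combinatorially: a correspondence
of the points of the circles that respects components, the order of travel from the base points,
the classical crossings and their signs. -/
structure PointCorrespondence (D D' : BasedDiagram n) (Φ : CirclePoint n → CirclePoint n) :
    Prop where
  fst_eq : ∀ P, (Φ P).1 = P.1
  surjective : Function.Surjective Φ
  position_lt : ∀ P Q, P.1 = Q.1 →
    (D.position (Φ P) < D.position (Φ Q) ↔ D'.position P < D'.position Q)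
  mem_classical : ∀ c, c ∈ D'.classical ↔ c.map Φ Φ ∈ D.classical
  crossingSign_eq : ∀ c ∈ D'.classical, D'.crossingSign c = D.crossingSign (c.map Φ Φ)

theorem SamePicture.exists_pointCorrespondence (h : SamePicture D D') :
    ∃ Φ, PointCorrespondence D D' Φ := by
  obtain ⟨Ψ, φ, ⟨-, hΨ, hdet⟩, hφ, hcurve, hbase, hcl⟩ := h
  choose lift hlift using UnitAddCircle.exists_coe_eq
  let Φ : CirclePoint n → CirclePoint n := fun P => (P.1, (φ P.1 (lift P.2) : UnitAddCircle))
  have hΦ : ∀ i (t : ℝ), Φ (i, t) = (i, (φ i t : UnitAddCircle)) := fun i t =>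
    Prod.ext rfl (coe_map_eq_of_coe_eq (hφ i).2.2 (hlift _))
  have hmono : ∀ i, StrictMono (φ i) := fun i => strictMono_of_deriv_pos (hφ i).2.1
  have hcoe : ∀ P : CirclePoint n, ∃ i, ∃ t : ℝ, P = (i, (t : UnitAddCircle)) := fun P =>
    ⟨P.1, lift P.2, Prod.ext rfl (hlift _).symm⟩
  have hmem : ∀ c, c ∈ D'.classical ↔ c.map Φ Φ ∈ D.classical := by
    rintro ⟨P, Q⟩
    obtain ⟨i, s, rfl⟩ := hcoe P
    obtain ⟨j, t, rfl⟩ := hcoe Q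
    simpa only [Prod.map_apply, hΦ] using hcl i j s t
  refine ⟨Φ, fun _ => rfl, fun P => ?_, ?_, hmem, ?_⟩
  · obtain ⟨i, t, rfl⟩ := hcoe P
    obtain ⟨s, rfl⟩ := surjective_of_map_add_one (hφ i).1.continuous (hφ i).2.2 t
    exact ⟨(i, s), hΦ i s⟩
  -- Both positions are measured from the lifted base point b. The difference lies in [0, 1) because
  -- φ increases and φ(b + 1) = φ(b) + 1, so it is the position itself; monotonicity of φ then gives
  -- the order.
  · have hpos : ∀ P : CirclePoint n, D.position (Φ P) =
        φ P.1 (lift (D'.base P.1) + D'.position P) - φ P.1 (lift (D'.base P.1)) := by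
      intro P
      set b := lift (D'.base P.1) with hb
      have hs := D'.position_mem P
      have hP : P = (P.1, ((b + D'.position P : ℝ) : UnitAddCircle)) :=
        Prod.ext rfl (by rw [AddCircle.coe_add, hlift, D'.base_add_position])
      have hD : D.base P.1 = (φ P.1 b : ℝ) := (hbase P.1 b).1 (hlift _).symm
      have h0 : φ P.1 b ≤ φ P.1 (b + D'.position P) := (hmono _).monotone (by linarith [hs.1])
      have h1 : φ P.1 (b + D'.position P) < φ P.1 b + 1 := by
        rw [← (hφ P.1).2.2]
        exact hmono _ (by linarith [hs.2])
      rw [← D.position_coe P.1 (s := φ P.1 (b + D'.position P) - φ P.1 b)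
        ⟨by linarith, by linarith⟩, hD, ← AddCircle.coe_add, add_sub_cancel, ← hΦ, ← hP]
    intro P Q hPQ
    rw [hpos P, hpos Q, hPQ, sub_lt_sub_iff_right, (hmono _).lt_iff_lt, add_lt_add_iff_left]
  · rintro ⟨P, Q⟩ hc
    have hd := (D.classical_double _ ((hmem _).1 hc)).2
    obtain ⟨i, s, rfl⟩ := hcoe P
    obtain ⟨j, t, rfl⟩ := hcoe Q
    simp only [Prod.map_apply, hΦ] at hd ⊢
    have hv := curveVelocity_eq_of_picture hΨ (fun i => (hφ i).1) hcurve
    -- By `hd` both velocities are transported by the derivative of Ψ at the same point, so the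
    -- determinant is only multiplied by positive numbers.
    simp only [VirtualLinkDiagram.crossingSign, hv, hd]
    set L := fderiv ℝ Ψ (D.curve (j, (φ j t : ℝ)))
    have hsmul : ∀ (x y : ℝ) (u v : ℝ × ℝ), planeDet (x • u) (y • v) = x * y * planeDet u v := by
      intro x y u v
      simp only [planeDet, Prod.smul_fst, Prod.smul_snd, smul_eq_mul]
      ring
    rw [hsmul, planeDet_map, sign_mul, sign_mul, sign_mul, sign_pos ((hφ i).2.1 s),
      sign_pos ((hφ j).2.1 t), sign_pos (hdet _)]
    simp

namespace PointCorrespondence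

variable {Φ : CirclePoint n → CirclePoint n}

theorem underCrossings_map (h : PointCorrespondence D D' Φ) (i : Fin n) :
    (D'.underCrossings i).map (Prod.map Φ Φ) = D.underCrossings i := by
  refine List.eq_of_pairwise_lt_of_mem_iff
    (fun d : CirclePoint n × CirclePoint n => D.position d.2) ?_ (D.underCrossings_pairwise i) ?_
  · refine List.pairwise_map.2 (List.Pairwise.imp_of_mem (fun {c d} hc hd hcd => ?_)
      (D'.underCrossings_pairwise i))
    exact (h.position_lt _ _ ((D'.mem_underCrossings.1 hc).2.trans
      (D'.mem_underCrossings.1 hd).2.symm)).2 hcd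
  · intro d
    simp only [List.mem_map, mem_underCrossings, h.mem_classical]
    constructor
    · rintro ⟨c, ⟨h1, h2⟩, rfl⟩
      exact ⟨h1, (h.fst_eq _).trans h2⟩
    · rintro ⟨h1, h2⟩
      obtain ⟨c, rfl⟩ := (h.surjective.prodMap h.surjective) d
      exact ⟨c, ⟨h1, (h.fst_eq _).symm.trans h2⟩, rfl⟩

variable {G : Type*} [Group G] (a : Fin n → G)

theorem crossingProd_map (h : PointCorrespondence D D' Φ) {g g' : CirclePoint n → G}
    (hg : ∀ P, g' P = g (Φ P)) {l : List (CirclePoint n × CirclePoint n)}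
    (hl : ∀ c ∈ l, c ∈ D'.classical) :
    D.crossingProd g (l.map (Prod.map Φ Φ)) = D'.crossingProd g' l := by
  rw [crossingProd, crossingProd, List.map_map]
  refine congrArg List.prod (List.map_congr_left fun c hc => ?_)
  simp only [Function.comp_apply, h.crossingSign_eq c (hl c hc), hg, Prod.map_fst]

theorem meridian_eq (h : PointCorrespondence D D' Φ) (q : ℕ) (P : CirclePoint n) :
    D'.meridian a q P = D.meridian a q (Φ P) := by
  induction q generalizing P with
  | zero => rfl
  | succ q ih =>
    have hf : (D.underCrossings P.1).filter (fun c => D.position c.2 < D.position (Φ P)) =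
        ((D'.underCrossings P.1).filter fun c => D'.position c.2 < D'.position P).map
          (Prod.map Φ Φ) := by
      rw [← h.underCrossings_map, List.filter_map]
      refine congrArg _ (List.filter_congr fun c hc => ?_)
      simp only [Function.comp_apply, Prod.map_snd,
        h.position_lt _ _ (D'.mem_underCrossings.1 hc).2]
    simp only [meridian, h.fst_eq]
    rw [hf, h.crossingProd_map ih fun c hc =>
      (D'.mem_underCrossings.1 (List.mem_of_mem_filter hc)).1]

theorem crossingProd_underCrossings_eq (h : PointCorrespondence D D' Φ) (q : ℕ) (i : Fin n) :
    D.crossingProd (D.meridian a q) (D.underCrossings i) =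
      D'.crossingProd (D'.meridian a q) (D'.underCrossings i) := by
  rw [← h.underCrossings_map, h.crossingProd_map (h.meridian_eq a q) fun c hc =>
    (D'.mem_underCrossings.1 hc).1]

end PointCorrespondence

/-! ### Conclusion -/

open NCPowerSeries in
/-- Two diagrams have the same Milnor numbers for a sequence `J i` without repeated indices if
their longitudes agree in the quotient that sees only words without repetitions avoiding `i`. -/
theorem milnorNumberAt_eq_of_crossingProd_eq {q : ℕ} {J : List (Fin n)} {i : Fin n}
    (hJ : J.Nodup) (hi : i ∉ J)
    (h : D.crossingProd (D.meridian (nodupMeridian i) q) (D.underCrossings i) =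
      D'.crossingProd (D'.meridian (nodupMeridian i) q) (D'.underCrossings i)) :
    D.milnorNumberAt q J i = D'.milnorNumberAt q J i := by
  -- Computing in the quotient group amounts to reading the relevant Magnus coefficients.
  have hlift : FreeGroup.lift (nodupMeridian i) =
      (Units.map (agreeOnNodup i).mk'.toMonoidHom).comp (magnusExpansion n) := by
    ext1 k
    simp [ArcData.magnusExpansion_of, nodupMeridian]
  rw [← D.lift_eta_preferredLongitude _ q (nodupMeridian_self i),
    ← D'.lift_eta_preferredLongitude _ q (nodupMeridian_self i), hlift] at h
  exact units_map_agreeOnNodup_eq.1 h J hJ hi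

end BasedDiagram

theorem mainTheorem5 {n : ℕ} (D D' : BasedDiagram n)
    (h : D.SelfCrossingVirtualization D') (J : List (Fin n)) (i : Fin n)
    (hI : (J ++ [i]).Nodup) :
    (∀ q, J.length < q → D.milnorNumberAt q J i = D.milnorNumber J i) ∧
    (∀ q, J.length < q → D'.milnorNumberAt q J i = D'.milnorNumber J i) ∧
    D.milnorNumber J i = D'.milnorNumber J i := by
  refine ⟨fun q hq => D.arcData.milnorNumberAt_eq i hq,
    fun q hq => D'.arcData.milnorNumberAt_eq i hq, ?_⟩
  obtain ⟨c, -, hc, hpic⟩ := h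
  obtain ⟨Φ, hΦ⟩ := hpic.exists_pointCorrespondence
  rw [List.nodup_append] at hI
  refine BasedDiagram.milnorNumberAt_eq_of_crossingProd_eq hI.1
    (fun hi => hI.2.2 i hi i (List.mem_singleton_self i) rfl) ?_
  rw [← hΦ.crossingProd_underCrossings_eq, BasedDiagram.crossingProd_virtualize
    (NCPowerSeries.commute_conj_nodupMeridian i) hc _ (NCPowerSeries.nodupMeridian_self i)]
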